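/- Let $G$ be a compact Lie group with normalized Haar measure $dx$, let $L^2(G)$ be the space of complex-valued square-integrable functions on $G$, and let $\mathcal L$ be the Laplace–Beltrami operator of a bi-invariant Riemannian metric on $G$. For every continuous irreducible unitary representation $\xi:G\to U(d_\xi)$ let $\lambda_\xi\ge 0$ be the number with $-\mathcal L\xi_{ij}=\lambda_\xi^2\,\xi_{ij}$ for all $i,j$ (it depends only on the equivalence class $[\xi]\in\widehat G$), and put $\widehat f(\xi)=\int_G f(x)\,\xi(x)^*\,dx$. For $s>0$ and $f,h\in L^2(G)$ we write $h=(-\mathcal L)^{s}f$ if $\widehat h(\xi)=\lambda_\xi^{2s}\,\widehat f(\xi)$ for all $[\xi]\in\widehat G$. For $\alpha>0$ let $H^\alpha_{\mathcal L}(G)=\{f\in L^2(G):(-\mathcal L)^{\alpha/2}f\in L^2(G)\}$, with norm $\|f\|_{H^\alpha_{\mathcal L}(G)}=\|f\|_{L^2(G)}+\|(-\mathcal L)^{\alpha/2}f\|_{L^2(G)}$. **Theorem 1.1.** Let $0<\alpha<1$. There is a constant $C>0$, independent of $u_0$, $u_1$, $u$ and $t$, with the following property. Let $(u_0,u_1)\in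 H^\alpha_{\mathcal L}(G)\times L^2(G)$ and let $u\in\mathcal C([0,\infty),H^\alpha_{\mathcal L}(G))\cap\mathcal C^1([0,\infty),L^2(G))$ be a solution of the homogeneous Cauchy problem $$\partial_t^2u+(-\mathcal L)^\alpha u=0\quad (t>0),\qquad u(0)=u_0,\qquad \partial_tu(0)=u_1,$$ where the equation is understood in the dual of $H^\alpha_{\mathcal L}(G)$: for all $w\in H^\alpha_{\mathcal L}(G)$ and all $t>0$, $$\frac{d}{dt}\langle \partial_tu(t),w\rangle_{L^2(G)}=-\big\langle(-\mathcal L)^{\alpha/2}u(t),(-\mathcal L)^{\alpha/2}w\big\rangle_{L^2(G)}.$$ Then, for all $t\ge 0$, $$\|u(t)\|_{L^2(G)}\le C\big[\|u_0\|_{L^2(G)}+t\,\|u_1\|_{L^2(G)}\big],$$ $$\big\|(-\mathcal L)^{\alpha/2}u(t)\big\|_{L^2(G)}\le C\big[\|u_0\|_{H^\alpha_{\mathcal L}(G)}+\|u_1\|_{L^2(G)}\big],$$ $$\|\partial_tu(t)\|_{L^2(G)}\le C\big[\|u_0\|_{H^\alpha_{\mathcal L}(G)}+\|u_1\|_{L^2(G)}\big].$$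 -/

import Mathlib

open MeasureTheory Filter Topology
open scoped Manifold ContDiff Matrix

noncomputable section

namespace FracWave

/-! ## The Laplace-Beltrami operator -/

section Laplacian

variable {n : ℕ} {M : Type*} [TopologicalSpace M] [ChartedSpace (EuclideanSpace ℝ (Fin n)) M]
  [IsManifold (𝓡 n) ∞ M]

/-- Smooth Riemannian metrics on an `n`-dimensional smooth manifold without boundary. -/
abbrev Metric (n : ℕ) (M : Type*) [TopologicalSpace M]
    [ChartedSpace (EuclideanSpace ℝ (Fin n)) M] [IsManifold (𝓡 n) ∞ M] : Type _ :=
  Bundle.ContMDiffRiemannianMetric (𝓡 n) ∞ (EuclideanSpace ℝ (Fin n))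
    (fun x : M => TangentSpace (𝓡 n) x)

/-- The `i`-th partial derivative of a function on `ℝⁿ`. -/
def partialDeriv {F : Type*} [NormedAddCommGroup F] [NormedSpace ℝ F] (i : Fin n)
    (h : EuclideanSpace ℝ (Fin n) → F) (y : EuclideanSpace ℝ (Fin n)) : F :=
  fderiv ℝ h y (EuclideanSpace.single i 1)

/-- The `i`-th coordinate vector field of the chart at `p`, at the point with coordinates `y`. -/
def coordVector (p : M) (i : Fin n) (y : EuclideanSpace ℝ (Fin n)) :
    TangentSpace (𝓡 n) ((extChartAt (𝓡 n) p).symm y) :=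
  mfderiv 𝓘(ℝ, EuclideanSpace ℝ (Fin n)) (𝓡 n) (extChartAt (𝓡 n) p).symm y
    (EuclideanSpace.single i (1 : ℝ) : EuclideanSpace ℝ (Fin n))

/-- The matrix `(g_{ij})` of the metric in the chart at `p`, at the point with coordinates `y`. -/
def gram (g : Metric n M) (p : M) (y : EuclideanSpace ℝ (Fin n)) : Matrix (Fin n) (Fin n) ℝ :=
  Matrix.of fun i j =>
    g.inner ((extChartAt (𝓡 n) p).symm y) (coordVector p i y) (coordVector p j y)

/-- The Laplace-Beltrami operator
`𝓛 f = |g|^{-1/2} ∑ᵢ ∂ᵢ (|g|^{1/2} ∑ⱼ g^{ij} ∂ⱼ f)`, where `|g| = det (g_{ij})`,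
computed at the point `p` in the chart at `p`. -/
def laplaceBeltrami (g : Metric n M) (f : M → ℂ) (p : M) : ℂ :=
  (((Real.sqrt (gram g p (extChartAt (𝓡 n) p p)).det)⁻¹ : ℝ) : ℂ) *
    ∑ i : Fin n, partialDeriv i
      (fun y => ((Real.sqrt (gram g p y).det : ℝ) : ℂ) *
        ∑ j : Fin n, (((gram g p y)⁻¹ i j : ℝ) : ℂ) *
          partialDeriv j (fun z => f ((extChartAt (𝓡 n) p).symm z)) y)
      (extChartAt (𝓡 n) p p)

end Laplacian

/-- A Riemannian metric on a Lie group is bi-invariant if all left and all right translations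
are isometries. -/
def IsBiinvariant {n : ℕ} {G : Type*} [TopologicalSpace G] [Group G]
    [ChartedSpace (EuclideanSpace ℝ (Fin n)) G] [LieGroup (𝓡 n) ∞ G]
    (g : Metric n G) : Prop :=
  (∀ (a x : G) (v w : TangentSpace (𝓡 n) x),
    g.inner (a * x) (mfderiv (𝓡 n) (𝓡 n) (fun y : G => a * y) x v)
      (mfderiv (𝓡 n) (𝓡 n) (fun y : G => a * y) x w) = g.inner x v w) ∧
  (∀ (a x : G) (v w : TangentSpace (𝓡 n) x),
    g.inner (x * a) (mfderiv (𝓡 n) (𝓡 n) (fun y : G => y * a) x v)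
      (mfderiv (𝓡 n) (𝓡 n) (fun y : G => y * a) x w) = g.inner x v w)

/-! ## Fourier analysis on the group -/

/-- Continuous irreducible unitary (matrix) representations of `G`. -/
structure Irrep (G : Type*) [Group G] [TopologicalSpace G] where
  /-- the dimension `d_ξ` -/
  dim : ℕ
  dim_pos : 0 < dim
  /-- the homomorphism into the unitary matrices -/
  hom : G →* Matrix.unitaryGroup (Fin dim) ℂ
  continuous_hom : Continuous hom
  irreducible : ∀ W : Submodule ℂ (Fin dim → ℂ),
    (∀ (x : G), ∀ v ∈ W, (hom x : Matrix (Fin dim) (Fin dim) ℂ) *ᵥ v ∈ W) → W = ⊥ ∨ W = ⊤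

/-- The matrix `ξ(x)`. -/
def Irrep.mat {G : Type*} [Group G] [TopologicalSpace G] (ξ : Irrep G) (x : G) :
    Matrix (Fin ξ.dim) (Fin ξ.dim) ℂ :=
  (ξ.hom x : Matrix (Fin ξ.dim) (Fin ξ.dim) ℂ)

/-- Equivalence of representations: there is an invertible intertwining operator. -/
def Irrep.Equivalent {G : Type*} [Group G] [TopologicalSpace G] (ξ η : Irrep G) : Prop :=
  ∃ T : (Fin ξ.dim → ℂ) ≃ₗ[ℂ] (Fin η.dim → ℂ),
    ∀ (x : G) (v : Fin ξ.dim → ℂ), T (ξ.mat x *ᵥ v) = η.mat x *ᵥ T v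

section Fourier

variable {n : ℕ} {G : Type*} [TopologicalSpace G] [Group G]
  [ChartedSpace (EuclideanSpace ℝ (Fin n)) G] [IsManifold (𝓡 n) ∞ G]

/-- `lam ≥ 0` is such that all matrix elements of all the representations in the class `[ξ]`
satisfy `-𝓛 ξ_{ij} = lam² ξ_{ij}`. -/
def IsEigenfrequency (g : Metric n G) (ξ : Irrep G) (lam : ℝ) : Prop :=
  0 ≤ lam ∧ ∀ η : Irrep G, ξ.Equivalent η → ∀ (i j : Fin η.dim) (x : G),
    -laplaceBeltrami g (fun y => η.mat y i j) x = ((lam ^ 2 : ℝ) : ℂ) * η.mat x i j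

open scoped Classical in
/-- The number `λ_ξ ≥ 0`, which depends only on the class `[ξ]`: for a bi-invariant metric on a
compact Lie group there is exactly one number as in `IsEigenfrequency` (otherwise the value is
the dummy `0`). -/
def eigenfrequency (g : Metric n G) (ξ : Irrep G) : ℝ :=
  if h : ∃ lam : ℝ, IsEigenfrequency g ξ lam then h.choose else 0

variable [MeasurableSpace G]

/-- The group Fourier transform `f̂(ξ) = ∫ f(x) ξ(x)^* dx`. -/
def fourier (μ : Measure G) (f : Lp ℂ 2 μ) (ξ : Irrep G) : Matrix (Fin ξ.dim) (Fin ξ.dim) ℂ :=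
  Matrix.of fun i j => ∫ x, f x * (ξ.mat x)ᴴ i j ∂μ

/-- `h = (-𝓛)^s f`, i.e. `ĥ(ξ) = (λ_ξ²)^s f̂(ξ)` for all `[ξ]` in the unitary dual. -/
def IsFracLaplacian (g : Metric n G) {μ : Measure G} (s : ℝ) (f h : Lp ℂ 2 μ) : Prop :=
  ∀ ξ : Irrep G, fourier μ h ξ = (((eigenfrequency g ξ ^ 2) ^ s : ℝ) : ℂ) • fourier μ f ξ

/-- The Sobolev space `H^α = {f ∈ L² : (-𝓛)^{α/2} f ∈ L²}`. -/
def MemSobolev (g : Metric n G) {μ : Measure G} (α : ℝ) (f : Lp ℂ 2 μ) : Prop :=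
  ∃ h : Lp ℂ 2 μ, IsFracLaplacian g (α / 2) f h

open scoped Classical in
/-- The function `(-𝓛)^s f ∈ L²` (with the dummy value `0` if it is not in `L²`). -/
def fracLaplacian (g : Metric n G) {μ : Measure G} (s : ℝ) (f : Lp ℂ 2 μ) : Lp ℂ 2 μ :=
  if h : ∃ h : Lp ℂ 2 μ, IsFracLaplacian g s f h then h.choose else 0

/-- `‖f‖_{H^α} = ‖f‖_{L²} + ‖(-𝓛)^{α/2} f‖_{L²}`, for `f ∈ H^α`. -/
def sobolevNorm (g : Metric n G) {μ : Measure G} (α : ℝ) (f : Lp ℂ 2 μ) : ℝ :=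
  ‖f‖ + ‖fracLaplacian g (α / 2) f‖

/-- The time derivative `∂ₜu` in `L²` of a curve on `[0, ∞)` (one-sided at `0`). -/
def timeDeriv {μ : Measure G} (u : ℝ → Lp ℂ 2 μ) (t : ℝ) : Lp ℂ 2 μ :=
  derivWithin u (Set.Ici 0) t

/-- `u ∈ C([0,∞), H^α) ∩ C¹([0,∞), L²)` solves `∂ₜ²u + (-𝓛)^α u = 0` with data `(u₀, u₁)`.
The equation holds for all `t > 0` in the dual of `H^α`, in which `(-𝓛)^α u(t)` is the functional
`w ↦ ⟪(-𝓛)^{α/2} w, (-𝓛)^{α/2} u(t)⟫`. The values of `u` at negative times play no role. -/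
structure IsSolution (g : Metric n G) {μ : Measure G} (α : ℝ) (u₀ u₁ : Lp ℂ 2 μ)
    (u : ℝ → Lp ℂ 2 μ) : Prop where
  memSobolev : ∀ t : ℝ, 0 ≤ t → MemSobolev g α (u t)
  continuous_sobolev : ∀ t : ℝ, 0 ≤ t →
    Tendsto (fun s => sobolevNorm g α (u s - u t)) (𝓝[Set.Ici 0] t) (𝓝 0)
  contDiff : ContDiffOn ℝ 1 u (Set.Ici 0)
  equation : ∀ w : Lp ℂ 2 μ, MemSobolev g α w → ∀ t : ℝ, 0 < t →
    HasDerivAt (fun s => inner ℂ w (timeDeriv u s))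
      (-inner ℂ (fracLaplacian g (α / 2) w) (fracLaplacian g (α / 2) (u t))) t
  initial_value : u 0 = u₀
  initial_velocity : timeDeriv u 0 = u₁

end Fourier

end FracWave

end

-- The equation decouples into harmonic oscillators. If `v` lies in the closed span of the matrix
-- elements with eigenfrequency `r`, then `φ = ⟪v, u⟫` satisfies `φ'' = -a² φ` with `a =
-- (r²)^(α/2)`. The oscillator conserves `|φ'|² + a² |φ|²`, and `φ(t) = cos(at) φ(0) + (sin(at)/a)
-- φ'(0)` with `|sin(at)/a| ≤ t` uniformly in `a`. Parseval over a Hilbert basis of such `v` turns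
-- these facts into `IsSolution.energy` and `IsSolution.norm_le`; only scalar functions are
-- differentiated twice.
--
-- Such a basis exists (`exists_hilbertBasis_spectralSpace`) because matrix elements of inequivalent
-- representations are orthogonal (Schur) and all matrix elements together are total
-- (`topologicalClosure_elementSpan`, Peter–Weyl). About `λ_ξ` the argument needs only that it is
-- constant on equivalence classes.

universe u

noncomputable section

set_option linter.unusedSectionVars false

namespace FracWave

/-! ## Left translations and matrix coefficients on a compact group -/

section CompactGroup

variable {G : Type*} [TopologicalSpace G] [Group G] [IsTopologicalGroup G] [CompactSpace G]
  [T2Space G] [SecondCountableTopology G] [MeasurableSpace G] [BorelSpace G]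
  (μ : Measure G) [μ.IsHaarMeasure] [IsProbabilityMeasure μ]

/-- The translation `f ↦ f(x ·)` on `L²(G)`. -/
def translate (x : G) : Lp ℂ 2 μ →ₗᵢ[ℂ] Lp ℂ 2 μ :=
  Lp.compMeasurePreservingₗᵢ ℂ (x * ·) (measurePreserving_mul_left μ x)

theorem coeFn_translate (x : G) (f : Lp ℂ 2 μ) : translate μ x f =ᵐ[μ] fun y => f (x * y) :=
  Lp.coeFn_compMeasurePreserving f (measurePreserving_mul_left μ x)

@[simp]
theorem translate_one (f : Lp ℂ 2 μ) : translate μ 1 f = f := by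
  ext1
  filter_upwards [coeFn_translate μ 1 f] with y hy
  simpa using hy

theorem translate_translate (x y : G) (f : Lp ℂ 2 μ) :
    translate μ x (translate μ y f) = translate μ (y * x) f := by
  ext1
  filter_upwards [coeFn_translate μ x (translate μ y f), coeFn_translate μ (y * x) f,
    (measurePreserving_mul_left μ x).quasiMeasurePreserving.ae (coeFn_translate μ y f)]
    with z h₁ h₂ h₃
  rw [h₁, h₂, h₃, mul_assoc]

theorem inner_translate_left (x : G) (f h : Lp ℂ 2 μ) :
    inner ℂ (translate μ x f) h = inner ℂ f (translate μ x⁻¹ h) := by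
  rw [← (translate μ x).inner_map_map f, translate_translate]
  simp

theorem inner_translate_right (x : G) (f h : Lp ℂ 2 μ) :
    inner ℂ f (translate μ x h) = inner ℂ (translate μ x⁻¹ f) h := by
  rw [inner_translate_left, inv_inv]

theorem continuous_translate (f : Lp ℂ 2 μ) : Continuous fun x => translate μ x f := by
  have h : Continuous fun x : G => (⟨fun y => x * y, continuous_const_mul x⟩ : C(G, G)) :=
    (ContinuousMap.curry ⟨fun p : G × G => p.1 * p.2, continuous_mul⟩).continuous
  exact (continuous_const (y := f)).compMeasurePreservingLp h
    (fun x => measurePreserving_mul_left μ x) (by simp)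

/-- The inclusion of the continuous functions into `L²`. -/
abbrev ofContinuous : C(G, ℂ) →L[ℂ] Lp ℂ 2 μ := ContinuousMap.toLp 2 μ ℂ

theorem translate_ofContinuous (x : G) (φ : C(G, ℂ)) :
    translate μ x (ofContinuous μ φ) =
      ofContinuous μ (φ.comp ⟨fun y => x * y, continuous_const_mul x⟩) := by
  ext1
  filter_upwards [coeFn_translate μ x (ofContinuous μ φ), ContinuousMap.coeFn_toLp (𝕜 := ℂ) (p := 2)
    μ (φ.comp ⟨fun y => x * y, continuous_const_mul x⟩),
    (measurePreserving_mul_left μ x).quasiMeasurePreserving.ae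
      (ContinuousMap.coeFn_toLp (𝕜 := ℂ) (p := 2) μ φ)] with y h₁ h₂ h₃
  rw [h₁, h₂, h₃]
  rfl

/-- The operator that sends `f` to the matrix coefficient `x ↦ ⟪κ, f(x ·)⟫`. -/
def coeffOp (κ : Lp ℂ 2 μ) : Lp ℂ 2 μ →L[ℂ] C(G, ℂ) :=
  LinearMap.mkContinuous
    { toFun := fun f => ⟨fun x => inner ℂ κ (translate μ x f),
        continuous_const.inner (continuous_translate μ f)⟩
      map_add' := fun f h => by ext x; simp [inner_add_right]
      map_smul' := fun c f => by ext x; simp [inner_smul_right] }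
    ‖κ‖ fun f => by
      refine (ContinuousMap.norm_le _ (by positivity)).2 fun x => ?_
      simpa using norm_inner_le_norm (𝕜 := ℂ) κ (translate μ x f)

@[simp]
theorem coeffOp_apply (κ f : Lp ℂ 2 μ) (x : G) :
    coeffOp μ κ f x = inner ℂ κ (translate μ x f) := rfl

/-- Arzelà–Ascoli: by unitarity the translation can be moved onto `κ`, so the images of the unit
ball share a modulus of continuity given by the translates of `κ` alone. -/
theorem isCompactOperator_coeffOp (κ : Lp ℂ 2 μ) : IsCompactOperator (coeffOp μ κ) := by
  let e := ContinuousMap.linearIsometryBoundedOfCompact G ℂ ℂ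
  let S : Lp ℂ 2 μ →L[ℂ] BoundedContinuousFunction G ℂ :=
    (e.toContinuousLinearEquiv : C(G, ℂ) →L[ℂ] BoundedContinuousFunction G ℂ).comp (coeffOp μ κ)
  have hS : IsCompactOperator S := by
    refine (isCompactOperator_iff_isCompact_closure_image_closedBall S.toLinearMap one_pos).2 ?_
    refine BoundedContinuousFunction.arzela_ascoli (Metric.closedBall 0 ‖κ‖)
      (isCompact_closedBall _ _) _ ?_ ?_
    · rintro _ x ⟨f, hf, rfl⟩
      rw [mem_closedBall_zero_iff] at hf ⊢
      calc ‖inner ℂ κ (translate μ x f)‖ ≤ ‖κ‖ * ‖translate μ x f‖ := norm_inner_le_norm _ _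
        _ ≤ ‖κ‖ * 1 := by rw [LinearIsometry.norm_map]; gcongr
        _ = ‖κ‖ := mul_one _
    · intro x₀
      refine Metric.equicontinuousAt_of_continuity_modulus
        (fun x => ‖translate μ x₀⁻¹ κ - translate μ x⁻¹ κ‖) ?_ _ ?_
      · have : Continuous fun x => ‖translate μ x₀⁻¹ κ - translate μ x⁻¹ κ‖ :=
          (continuous_const.sub ((continuous_translate μ κ).comp continuous_inv)).norm
        simpa using this.tendsto x₀
      · refine Eventually.of_forall ?_
        rintro x ⟨_, f, hf, rfl⟩
        rw [mem_closedBall_zero_iff] at hf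
        change dist (inner ℂ κ (translate μ x₀ f)) (inner ℂ κ (translate μ x f)) ≤ _
        rw [inner_translate_right, inner_translate_right, dist_eq_norm, ← inner_sub_left]
        exact (norm_inner_le_norm _ _).trans (mul_le_of_le_one_right (norm_nonneg _) hf)
  have h := hS.clm_comp 
    (e.symm.toContinuousLinearEquiv : BoundedContinuousFunction G ℂ →L[ℂ] C(G, ℂ))
  exact h

/-- The matrix element `ξ_{ij}`, as a continuous function. -/
def Irrep.elementMap (ξ : Irrep G) (i j : Fin ξ.dim) : C(G, ℂ) :=
  ⟨fun x => ξ.mat x i j, by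
    have h : Continuous fun x => (ξ.hom x : Matrix (Fin ξ.dim) (Fin ξ.dim) ℂ) :=
      continuous_subtype_val.comp ξ.continuous_hom
    exact h.matrix_elem i j⟩

/-- The matrix element `ξ_{ij}`, as an element of `L²`. -/
def Irrep.element (ξ : Irrep G) (i j : Fin ξ.dim) : Lp ℂ 2 μ :=
  ofContinuous μ (ξ.elementMap i j)

/-- The span of all the matrix elements of irreducible representations. -/
def elementSpan : Submodule ℂ (Lp ℂ 2 μ) :=
  Submodule.span ℂ {f | ∃ (ξ : Irrep G) (i j : Fin ξ.dim), ξ.element μ i j = f}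

theorem element_mem_elementSpan (ξ : Irrep G) (i j : Fin ξ.dim) :
    ξ.element μ i j ∈ elementSpan μ :=
  Submodule.subset_span ⟨ξ, i, j, rfl⟩

/-- Turns every condition on Fourier coefficients into Hilbert space geometry. The indices swap
because of the adjoint in `f̂`. -/
theorem fourier_apply (f : Lp ℂ 2 μ) (ξ : Irrep G) (i j : Fin ξ.dim) :
    fourier μ f ξ i j = inner ℂ (ξ.element μ j i) f := by
  rw [L2.inner_def]
  refine integral_congr_ae ?_
  filter_upwards [ContinuousMap.coeFn_toLp (𝕜 := ℂ) (p := 2) μ (ξ.elementMap j i)] with x hx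
  rw [Irrep.element, hx]
  simp only [RCLike.inner_apply, Matrix.conjTranspose_apply]
  rfl

/-! ## The Peter–Weyl theorem -/

/-- A finite-dimensional subspace of `L²(G)` without proper translation-invariant subspaces gives
an irreducible unitary representation. -/
theorem exists_irrep_of_irreducible (V : Submodule ℂ (Lp ℂ 2 μ)) [FiniteDimensional ℂ V]
    (hV₀ : V ≠ ⊥) (hV : ∀ (x : G), ∀ v ∈ V, translate μ x v ∈ V)
    (hirr : ∀ W : Submodule ℂ (Lp ℂ 2 μ), W ≤ V → (∀ (x : G), ∀ v ∈ W, translate μ x v ∈ W) →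
      W = ⊥ ∨ W = V) :
    ∃ (ξ : Irrep G) (b : OrthonormalBasis (Fin ξ.dim) ℂ V),
      ∀ (x : G) (i : Fin ξ.dim), translate μ x (b i) = ∑ j, ξ.mat x i j • (b j : Lp ℂ 2 μ) := by
  let b := stdOrthonormalBasis ℂ V
  -- `translate` reverses products, so the coefficients of the image of `b i` are put in row `i`,
  -- not column `i`; this makes `A` multiplicative.
  let A : G → Matrix (Fin (Module.finrank ℂ V)) (Fin (Module.finrank ℂ V)) ℂ := fun x =>
    Matrix.of fun i j => inner ℂ (b j : Lp ℂ 2 μ) (translate μ x (b i))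
  have hA : ∀ x i, translate μ x (b i) = ∑ j, A x i j • (b j : Lp ℂ 2 μ) := by
    intro x i
    have h := congrArg (Submodule.subtype V) (b.sum_repr' ⟨_, hV x _ (b i).2⟩)
    simpa [A] using h.symm
  have hb : ∀ i j, inner ℂ (b i : Lp ℂ 2 μ) (b j) = if i = j then (1 : ℂ) else 0 := by
    intro i j
    exact orthonormal_iff_ite.1 b.orthonormal i j
  have hmul : ∀ x y, A (x * y) = A x * A y := by
    intro x y
    ext i k
    change inner ℂ (b k : Lp ℂ 2 μ) (translate μ (x * y) (b i)) = _
    rw [← translate_translate, hA x i, map_sum, inner_sum, Matrix.mul_apply]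
    refine Finset.sum_congr rfl fun j _ => ?_
    rw [map_smul, inner_smul_right]
    rfl
  have hone : A 1 = 1 := by
    ext i j
    change inner ℂ (b j : Lp ℂ 2 μ) (translate μ 1 (b i)) = _
    rw [translate_one, hb, Matrix.one_apply]
    simp only [eq_comm]
  have hstar : ∀ x, (A x)ᴴ = A x⁻¹ := by
    intro x
    ext i j
    change star (inner ℂ (b i : Lp ℂ 2 μ) (translate μ x (b j))) =
      inner ℂ (b j : Lp ℂ 2 μ) (translate μ x⁻¹ (b i))
    rw [← inner_translate_left, ← inner_conj_symm]
    simp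
  let hom : G →* Matrix.unitaryGroup (Fin (Module.finrank ℂ V)) ℂ :=
    { toFun := fun x => ⟨A x, by
        rw [Matrix.mem_unitaryGroup_iff, Matrix.star_eq_conjTranspose, hstar, ← hmul,
          mul_inv_cancel, hone]⟩
      map_one' := Subtype.ext hone
      map_mul' := fun x y => Subtype.ext (hmul x y) }
  let ξ : Irrep G :=
    { dim := Module.finrank ℂ V
      dim_pos := by
        have : Nontrivial V := Submodule.nontrivial_iff_ne_bot.2 hV₀
        exact Module.finrank_pos
      hom := hom
      continuous_hom := by
        refine Continuous.subtype_mk (continuous_matrix fun i j => ?_) _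
        exact continuous_const.inner (continuous_translate μ _)
      irreducible := by
        intro W hW
        -- Since `A` is the transpose of the action on `V`, an invariant `W` lives in the dual of
        -- `V`. The bilinear pairing `φ` transfers it to its annihilator, where the irreducibility
        -- of `V` applies.
        let φ : (Fin (Module.finrank ℂ V) → ℂ) → Lp ℂ 2 μ →ₗ[ℂ] ℂ := fun w =>
          ∑ i, w i • (innerₛₗ ℂ (b i : Lp ℂ 2 μ))
        have hφ : ∀ w v, φ w v = ∑ i, w i * inner ℂ (b i : Lp ℂ 2 μ) v := by
          intro w v
          simp [φ]
        -- the annihilator of `W` in `V`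
        let W' : Submodule ℂ (Lp ℂ 2 μ) := V ⊓ ⨅ w ∈ W, LinearMap.ker (φ w)
        have hmem : ∀ v, v ∈ W' ↔ v ∈ V ∧ ∀ w ∈ W, φ w v = 0 := by
          intro v
          simp [W', Submodule.mem_inf, Submodule.mem_iInf]
        have hexp : ∀ v ∈ V, v = ∑ i, inner ℂ (b i : Lp ℂ 2 μ) v • (b i : Lp ℂ 2 μ) := by
          intro v hv
          have h := congrArg (Submodule.subtype V) (b.sum_repr' ⟨v, hv⟩)
          simpa using h.symm
        have hbb : ∀ w i, φ w (b i) = w i := by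
          intro w i
          simp [hφ, hb]
        have hφA : ∀ x w, ∀ v ∈ V, φ w (translate μ x v) = φ (A x *ᵥ w) v := by
          intro x w v hv
          rw [hexp v hv]
          simp only [map_sum, map_smul, hA, hbb, smul_eq_mul, Matrix.mulVec, dotProduct]
        have hinv : ∀ (x : G), ∀ v ∈ W', translate μ x v ∈ W' := by
          intro x v hv
          rw [hmem] at hv ⊢
          exact ⟨hV x v hv.1, fun w hw => by rw [hφA x w v hv.1]; exact hv.2 _ (hW x w hw)⟩
        rcases hirr W' inf_le_left hinv with h | h
        · right
          by_contra hne
          -- A nonzero functional vanishing on `W` is the pairing with some vector of `V`, which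
          -- then lies in the zero annihilator.
          obtain ⟨f, hf₀, hf⟩ := Submodule.exists_le_ker_of_lt_top W (lt_top_iff_ne_top.2 hne)
          have hfw : ∀ w, φ w (∑ i, f (Pi.single i 1) • (b i : Lp ℂ 2 μ)) = f w := by
            intro w
            conv_rhs => rw [← Finset.univ_sum_single w]
            rw [map_sum, map_sum]
            refine Finset.sum_congr rfl fun i _ => ?_
            rw [map_smul, hbb, smul_eq_mul, mul_comm, ← smul_eq_mul, ← map_smul, ← Pi.single_smul,
              smul_eq_mul, mul_one]
          have hv : (∑ i, f (Pi.single i 1) • (b i : Lp ℂ 2 μ)) ∈ W' := by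
            rw [hmem]
            exact ⟨Submodule.sum_mem _ fun i _ => V.smul_mem _ (b i).2,
              fun w hw => by rw [hfw]; exact hf hw⟩
          rw [h, Submodule.mem_bot] at hv
          refine hf₀ (LinearMap.ext fun w => ?_)
          rw [← hfw w, hv, map_zero, LinearMap.zero_apply]
        · left
          refine (Submodule.eq_bot_iff _).2 fun w hw => funext fun i => ?_
          have hi : (b i : Lp ℂ 2 μ) ∈ W' := by rw [h]; exact (b i).2
          rw [← hbb w i]
          exact ((hmem _).1 hi).2 w hw }
  exact ⟨ξ, b, hA⟩

/-- Induction on the dimension of `V`. For irreducible `V`, expanding in the orthonormal basis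
writes the coefficient in matrix elements; otherwise an invariant subspace splits off, its
orthogonal complement in `V` being invariant by unitarity. -/
theorem coeffOp_mem_elementSpan (κ : Lp ℂ 2 μ) (V : Submodule ℂ (Lp ℂ 2 μ))
    [FiniteDimensional ℂ V] (hV : ∀ (x : G), ∀ v ∈ V, translate μ x v ∈ V) {v : Lp ℂ 2 μ}
    (hv : v ∈ V) : ofContinuous μ (coeffOp μ κ v) ∈ elementSpan μ := by
  obtain ⟨d, hd⟩ : ∃ d, Module.finrank ℂ V = d := ⟨_, rfl⟩
  induction d using Nat.strong_induction_on generalizing V v with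
  | _ d ih =>
    by_cases hV₀ : V = ⊥
    · rw [hV₀, Submodule.mem_bot] at hv
      simp [hv]
    by_cases hirr : ∀ W : Submodule ℂ (Lp ℂ 2 μ), W ≤ V →
        (∀ (x : G), ∀ v ∈ W, translate μ x v ∈ W) → W = ⊥ ∨ W = V
    · obtain ⟨ξ, b, hb⟩ := exists_irrep_of_irreducible μ V hV₀ hV hirr
      have hbi : ∀ i, ofContinuous μ (coeffOp μ κ (b i)) ∈ elementSpan μ := by
        intro i
        have h : coeffOp μ κ (b i) = ∑ j, inner ℂ κ (b j : Lp ℂ 2 μ) • ξ.elementMap i j := by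
          ext x
          rw [coeffOp_apply, hb, inner_sum, ContinuousMap.sum_apply]
          refine Finset.sum_congr rfl fun j _ => ?_
          rw [inner_smul_right, mul_comm]
          rfl
        rw [h, map_sum]
        refine Submodule.sum_mem _ fun j _ => ?_
        rw [map_smul]
        exact Submodule.smul_mem _ _ (element_mem_elementSpan μ ξ i j)
      have h := congrArg (Submodule.subtype V) (b.sum_repr' ⟨v, hv⟩)
      simp only [map_sum, map_smul, Submodule.subtype_apply] at h
      rw [← h, map_sum, map_sum]
      refine Submodule.sum_mem _ fun i _ => ?_
      rw [map_smul, map_smul]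
      exact Submodule.smul_mem _ _ (hbi i)
    · push Not at hirr
      obtain ⟨W, hWV, hW, hW₀, hW₁⟩ := hirr
      have : FiniteDimensional ℂ W := Submodule.finiteDimensional_of_le hWV
      have hsplit : W ⊔ (Wᗮ ⊓ V) = V := by
        exact Submodule.sup_orthogonal_inf_of_hasOrthogonalProjection hWV
      have hlt : W < V := lt_of_le_of_ne hWV hW₁
      have hlt' : Wᗮ ⊓ V < V := by
        refine lt_of_le_of_ne inf_le_right fun h => hW₀ ?_
        have hle : W ≤ Wᗮ := hWV.trans (inf_eq_right.1 h)
        exact (Submodule.isOrtho_self).1 hle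
      have hinv : ∀ (x : G), ∀ v ∈ Wᗮ ⊓ V, translate μ x v ∈ Wᗮ ⊓ V := by
        intro x v hv
        refine ⟨fun w hw => ?_, hV x v hv.2⟩
        rw [inner_translate_right]
        exact hv.1 _ (hW _ w hw)
      have : FiniteDimensional ℂ (Wᗮ ⊓ V : Submodule ℂ (Lp ℂ 2 μ)) :=
        Submodule.finiteDimensional_of_le inf_le_right
      rw [← hsplit] at hv
      obtain ⟨w, hw, w', hw', rfl⟩ := Submodule.mem_sup.1 hv
      rw [map_add, map_add]
      refine Submodule.add_mem _
        (ih _ (hd ▸ Submodule.finrank_lt_finrank_of_lt hlt) W hW hw rfl)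
        (ih _ (hd ▸ Submodule.finrank_lt_finrank_of_lt hlt') _ hinv hw' rfl)

/-- Spectral theorem for the compact self-adjoint `S = A* A`, which commutes with translations: its
eigenspaces span a dense subspace, and those with nonzero eigenvalue are finite-dimensional and
invariant. -/
theorem coeffOp_mem_closure (κ f : Lp ℂ 2 μ) :
    ofContinuous μ (coeffOp μ κ f) ∈ (elementSpan μ).topologicalClosure := by
  let A : Lp ℂ 2 μ →L[ℂ] Lp ℂ 2 μ := (ofContinuous μ).comp (coeffOp μ κ)
  let S : Lp ℂ 2 μ →L[ℂ] Lp ℂ 2 μ := (ContinuousLinearMap.adjoint A).comp A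
  have hA : IsCompactOperator A := (isCompactOperator_coeffOp μ κ).clm_comp (ofContinuous μ)
  have hS : IsCompactOperator S := hA.clm_comp (ContinuousLinearMap.adjoint A)
  have hsymm : S.IsSymmetric := by
    intro f h
    change inner ℂ (ContinuousLinearMap.adjoint A (A f)) h =
      inner ℂ f (ContinuousLinearMap.adjoint A (A h))
    rw [ContinuousLinearMap.adjoint_inner_left, ContinuousLinearMap.adjoint_inner_right]
  have hcomm : ∀ x f, A (translate μ x f) = translate μ x (A f) := by
    intro x f
    change ofContinuous μ _ = translate μ x (ofContinuous μ _)
    rw [translate_ofContinuous]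
    congr 1
    ext y
    simp [translate_translate]
  have hcomm' : ∀ x f, S (translate μ x f) = translate μ x (S f) := by
    intro x f
    refine ext_inner_right ℂ fun h => ?_
    change inner ℂ (ContinuousLinearMap.adjoint A (A _)) h =
      inner ℂ (translate μ x (ContinuousLinearMap.adjoint A (A f))) h
    rw [inner_translate_left, ContinuousLinearMap.adjoint_inner_left, hcomm,
      inner_translate_left, ← hcomm, ContinuousLinearMap.adjoint_inner_left]
  have heig : ∀ c, Module.End.eigenspace (S : Module.End ℂ (Lp ℂ 2 μ)) c ≤
      (elementSpan μ).topologicalClosure.comap A.toLinearMap := by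
    intro c v hv
    have hSv : S v = c • v := Module.End.mem_eigenspace_iff.1 hv
    by_cases hc : c = 0
    · have h0 : inner ℂ (A v) (A v) = 0 := by
        rw [← ContinuousLinearMap.adjoint_inner_left]
        change inner ℂ (S v) v = 0
        simp [hSv, hc]
      change A v ∈ (elementSpan μ).topologicalClosure
      rw [inner_self_eq_zero.1 h0]
      exact Submodule.zero_mem _
    · have : FiniteDimensional ℂ (Module.End.eigenspace (S : Module.End ℂ (Lp ℂ 2 μ)) c) :=
        ContinuousLinearMap.finite_dimensional_eigenspace hS c hc
      refine Submodule.le_topologicalClosure _ (coeffOp_mem_elementSpan μ κ _ (fun x w hw => ?_) hv)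
      have hSw : S w = c • w := Module.End.mem_eigenspace_iff.1 hw
      refine Module.End.mem_eigenspace_iff.2 ?_
      change S (translate μ x w) = _
      rw [hcomm', hSw, map_smul]
  have hcl : IsClosed (((elementSpan μ).topologicalClosure.comap A.toLinearMap :
      Submodule ℂ (Lp ℂ 2 μ)) : Set (Lp ℂ 2 μ)) :=
    (elementSpan μ).isClosed_topologicalClosure.preimage A.continuous
  have htop : (⨆ c, Module.End.eigenspace (S : Module.End ℂ (Lp ℂ 2 μ)) c).topologicalClosure = ⊤ :=
    Submodule.topologicalClosure_eq_top_iff.2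
      (ContinuousLinearMap.orthogonalComplement_iSup_eigenspaces_eq_bot hS hsymm)
  have hf : f ∈ (⨆ c, Module.End.eigenspace (S : Module.End ℂ (Lp ℂ 2 μ)) c).topologicalClosure :=
    htop ▸ Submodule.mem_top
  exact Submodule.topologicalClosure_minimal _ (iSup_le heig) hcl hf

/-- **Peter–Weyl**: the matrix elements of the irreducible representations span `L²(G)`. -/
theorem topologicalClosure_elementSpan : (elementSpan μ).topologicalClosure = ⊤ := by
  rw [Submodule.topologicalClosure_eq_top_iff, Submodule.eq_bot_iff]
  intro f hf
  have hdense : DenseRange (ofContinuous μ : C(G, ℂ) → Lp ℂ 2 μ) :=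
    ContinuousMap.toLp_denseRange ℂ μ ℂ (by simp)
  have hf' : ∀ κ h : Lp ℂ 2 μ, inner ℂ f (ofContinuous μ (coeffOp μ κ h)) = 0 := by
    intro κ h
    rw [← Submodule.orthogonal_closure] at hf
    exact Submodule.inner_left_of_mem_orthogonal (coeffOp_mem_closure μ κ h) hf
  suffices h : ∀ φ : C(G, ℂ), inner ℂ f (ofContinuous μ φ) = 0 by
    have h0 : (fun h => inner ℂ f h) = fun _ : Lp ℂ 2 μ => (0 : ℂ) :=
      hdense.equalizer (continuous_const.inner continuous_id) continuous_const (funext h)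
    exact inner_self_eq_zero.1 (congrFun h0 f)
  intro φ
  -- The function `∫ k x • F x` pairs with each `κ` to `⟪f, ⟪κ, φ(x ·)⟫⟫ = 0`, so it vanishes, and
  -- its value at `1` is `⟪f, φ⟫`. Integrating in `C(G, ℂ)` rather than in `L²` makes the evaluation
  -- at a point legitimate and replaces an approximate identity.
  let F : C(G, C(G, ℂ)) := ContinuousMap.curry ⟨fun p : G × G => φ (p.1 * p.2), by fun_prop⟩
  let k : G → ℂ := fun x => starRingEnd ℂ (f x)
  have hk : Integrable k μ := by
    have h : Integrable (f : G → ℂ) μ := (Lp.memLp f).integrable (by simp)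
    exact (Complex.conjLIE.toContinuousLinearEquiv : ℂ →L[ℝ] ℂ).integrable_comp h
  have hF : Integrable (fun x => k x • F x) μ := by
    refine hk.smul_bdd ‖F‖ F.continuous.aestronglyMeasurable ?_
    exact Eventually.of_forall fun x => F.norm_coe_le_norm x
  have hinner : ∀ ψ : C(G, ℂ), inner ℂ f (ofContinuous μ ψ) = ∫ x, k x * ψ x ∂μ := by
    intro ψ
    rw [L2.inner_def]
    refine integral_congr_ae ?_
    filter_upwards [ContinuousMap.coeFn_toLp (𝕜 := ℂ) (p := 2) μ ψ] with x hx
    rw [hx]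
    simp [k, mul_comm]
  have hzero : ofContinuous μ (∫ x, k x • F x ∂μ) = 0 := by
    refine ext_inner_left ℂ fun κ => ?_
    rw [inner_zero_right, ← innerSL_apply_apply ℂ, ← ContinuousLinearMap.integral_comp_comm _ hF,
      ← ContinuousLinearMap.integral_comp_comm]
    · rw [← hf' κ (ofContinuous μ φ), hinner]
      refine integral_congr_ae (Eventually.of_forall fun x => ?_)
      simp only [coeffOp_apply, translate_ofContinuous, map_smul, smul_eq_mul, innerSL_apply_apply]
      rfl
    · exact (ofContinuous μ).integrable_comp hF
  have hzero' : ∫ x, k x • F x ∂μ = 0 :=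
    ContinuousMap.toLp_injective (𝕜 := ℂ) (p := 2) μ (hzero.trans (map_zero _).symm)
  have heval := congrArg (fun ψ : C(G, ℂ) => ψ 1) hzero'
  rw [hinner]
  have hcomm := ContinuousLinearMap.integral_comp_comm (ContinuousMap.evalCLM ℂ (1 : G)) hF
  change _ = (∫ x, k x • F x ∂μ) 1 at hcomm
  rw [hzero'] at hcomm
  rw [← show (0 : C(G, ℂ)) 1 = 0 from rfl, ← hcomm]
  refine integral_congr_ae (Eventually.of_forall fun x => ?_)
  change k x * φ x = k x * φ (x * 1)
  rw [mul_one]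

/-! ## Schur orthogonality -/

theorem translate_element (ξ : Irrep G) (a : G) (i j : Fin ξ.dim) :
    translate μ a (ξ.element μ i j) = ∑ k, ξ.mat a i k • ξ.element μ k j := by
  simp only [Irrep.element]
  rw [translate_ofContinuous]
  simp only [← map_smul, ← map_sum]
  congr 1
  ext x
  rw [ContinuousMap.sum_apply]
  change (ξ.hom (a * x) : Matrix (Fin ξ.dim) (Fin ξ.dim) ℂ) i j = _
  rw [map_mul, Matrix.UnitaryGroup.mul_val, Matrix.mul_apply]
  rfl

theorem Irrep.conj_mat_inv (ξ : Irrep G) (a : G) (i j : Fin ξ.dim) :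
    starRingEnd ℂ (ξ.mat a⁻¹ i j) = ξ.mat a j i := by
  have h : ξ.mat a⁻¹ = star (ξ.mat a) := by
    simp only [Irrep.mat, map_inv]
    rfl
  rw [h, Matrix.star_apply]
  simp

theorem Irrep.Equivalent.symm {ξ η : Irrep G} (h : ξ.Equivalent η) : η.Equivalent ξ := by
  obtain ⟨T, hT⟩ := h
  refine ⟨T.symm, fun x v => ?_⟩
  rw [LinearEquiv.symm_apply_eq, hT, LinearEquiv.apply_symm_apply]

theorem Irrep.Equivalent.trans {ξ η ζ : Irrep G} (h : ξ.Equivalent η) (h' : η.Equivalent ζ) :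
    ξ.Equivalent ζ := by
  obtain ⟨T, hT⟩ := h
  obtain ⟨T', hT'⟩ := h'
  exact ⟨T.trans T', fun x v => by simp [hT, hT']⟩

/-- **Schur's lemma**. -/
theorem Irrep.eq_zero_of_intertwines {ξ η : Irrep G} (h : ¬ξ.Equivalent η)
    (T : (Fin ξ.dim → ℂ) →ₗ[ℂ] (Fin η.dim → ℂ))
    (hT : ∀ x v, T (ξ.mat x *ᵥ v) = η.mat x *ᵥ T v) : T = 0 := by
  rcases ξ.irreducible (LinearMap.ker T) (fun x v hv => by
    rw [LinearMap.mem_ker] at hv ⊢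
    exact (hT x v).trans (by rw [hv, Matrix.mulVec_zero])) with hker | hker
  · rcases η.irreducible (LinearMap.range T) (by
      rintro x _ ⟨v, rfl⟩
      exact ⟨ξ.mat x *ᵥ v, hT x v⟩) with hrange | hrange
    · exact LinearMap.range_eq_bot.1 hrange
    · exact absurd ⟨LinearEquiv.ofBijective T
        ⟨LinearMap.ker_eq_bot.1 hker, LinearMap.range_eq_top.1 hrange⟩, hT⟩ h
  · exact LinearMap.ker_eq_top.1 hker

/-- For fixed column indices `j` and `l`, the inner products form a matrix that intertwines `ξ` and
`η`, because translations are unitary and act on row indices. Schur's lemma makes it zero. -/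
theorem inner_element_of_not_equivalent {ξ η : Irrep G} (h : ¬ξ.Equivalent η)
    (i j : Fin ξ.dim) (k l : Fin η.dim) :
    inner ℂ (ξ.element μ i j) (η.element μ k l) = 0 := by
  let T : Matrix (Fin η.dim) (Fin ξ.dim) ℂ :=
    Matrix.of fun k i => inner ℂ (ξ.element μ i j) (η.element μ k l)
  have hT : ∀ a, T * ξ.mat a = η.mat a * T := by
    intro a
    ext m i
    have h₁ : inner ℂ (ξ.element μ i j) (translate μ a (η.element μ m l)) =
        (η.mat a * T) m i := by
      rw [translate_element, inner_sum, Matrix.mul_apply]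
      exact Finset.sum_congr rfl fun k _ => inner_smul_right _ _ _
    have h₂ : inner ℂ (ξ.element μ i j) (translate μ a (η.element μ m l)) =
        (T * ξ.mat a) m i := by
      rw [inner_translate_right, translate_element, sum_inner, Matrix.mul_apply]
      refine Finset.sum_congr rfl fun k _ => ?_
      rw [inner_smul_left, Irrep.conj_mat_inv, mul_comm]
      rfl
    rw [← h₁, ← h₂]
  have hzero : Matrix.toLin' T = 0 := Irrep.eq_zero_of_intertwines h _ fun x v => by
    rw [Matrix.toLin'_apply, Matrix.toLin'_apply, Matrix.mulVec_mulVec, Matrix.mulVec_mulVec, hT]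
  have hT₀ : T = 0 := Matrix.toLin'.map_eq_zero_iff.1 hzero
  exact congrFun (congrFun hT₀ k) i

end CompactGroup

/-! ## Hilbert bases -/

/-- Hilbert bases of the individual `V r` are put together; a vector orthogonal to all of them is
orthogonal to every `V r`. -/
theorem exists_hilbertBasis_of_closed_family {I : Type} {E : Type u} [NormedAddCommGroup E]
    [InnerProductSpace ℂ E] [CompleteSpace E] (V : I → Submodule ℂ E)
    (hclosed : ∀ r, IsClosed (V r : Set E))
    (hortho : ∀ r s, r ≠ s → ∀ f ∈ V r, ∀ h ∈ V s, inner ℂ f h = 0)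
    (htotal : ∀ f, (∀ r, ∀ v ∈ V r, inner ℂ f v = 0) → f = 0) :
    ∃ (ι : Type u) (r : ι → I) (b : HilbertBasis ι ℂ E), ∀ k, b k ∈ V (r k) := by
  have hcomplete : ∀ r, CompleteSpace (V r) := fun r => (hclosed r).completeSpace_coe
  choose w b _ using fun r => exists_hilbertBasis ℂ (V r)
  have hfamily : OrthogonalFamily ℂ (fun r => V r) fun r => (V r).subtypeₗᵢ :=
    fun r s hrs f h => hortho r s hrs f f.2 h h.2
  have hon : Orthonormal ℂ fun k : Σ r, w r => (b k.1 k.2 : E) :=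
    hfamily.orthonormal_sigma_orthonormal fun r => (b r).orthonormal
  refine ⟨Σ r, w r, Sigma.fst, HilbertBasis.mkOfOrthogonalEqBot hon ?_, fun k => ?_⟩
  · refine (Submodule.eq_bot_iff _).2 fun f hf => htotal f fun r v hv => ?_
    have h := ((innerSL ℂ f).comp (V r).subtypeL).hasSum ((b r).hasSum_repr ⟨v, hv⟩)
    refine h.unique ?_
    convert hasSum_zero using 2 with k
    have hk : inner ℂ f (b r k : E) = 0 :=
      Submodule.inner_left_of_mem_orthogonal
        (Submodule.subset_span (Set.mem_range_self (⟨r, k⟩ : Σ r, w r))) hf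
    simp [hk]
  · rw [HilbertBasis.coe_mkOfOrthogonalEqBot]
    exact (b k.1 k.2).2

theorem hasSum_norm_inner_sq {ι E : Type*} [NormedAddCommGroup E] [InnerProductSpace ℂ E]
    (b : HilbertBasis ι ℂ E) (f : E) :
    HasSum (fun k => ‖inner ℂ (b k) f‖ ^ 2) (‖f‖ ^ 2) := by
  have h := b.hasSum_inner_mul_inner f f
  have hk : ∀ k, inner ℂ f (b k) * inner ℂ (b k) f = ((‖inner ℂ (b k) f‖ ^ 2 : ℝ) : ℂ) := by
    intro k
    rw [← inner_conj_symm f (b k), RCLike.conj_mul]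
    push_cast
    rfl
  rw [inner_self_eq_norm_sq_to_K] at h
  simp only [hk] at h
  exact Complex.hasSum_ofReal.1 (by simpa using h)

/-! ## Spectral decomposition of the fractional Laplacian -/

section Spectral

variable {n : ℕ} {G : Type u} [TopologicalSpace G] [Group G] [IsTopologicalGroup G]
  [CompactSpace G] [T2Space G] [SecondCountableTopology G]
  [ChartedSpace (EuclideanSpace ℝ (Fin n)) G] [IsManifold (𝓡 n) ∞ G]
  [MeasurableSpace G] [BorelSpace G]
  (μ : Measure G) [μ.IsHaarMeasure] [IsProbabilityMeasure μ] (g : Metric n G)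

/-- The defining predicate quantifies over the whole class, so the predicates of `ξ` and `η` are
equal and the same number is chosen from both. -/
theorem eigenfrequency_congr {ξ η : Irrep G} (h : ξ.Equivalent η) :
    eigenfrequency g ξ = eigenfrequency g η := by
  have h' : IsEigenfrequency g ξ = IsEigenfrequency g η := by
    ext lam
    exact ⟨fun H => ⟨H.1, fun ζ hζ => H.2 ζ (h.trans hζ)⟩,
      fun H => ⟨H.1, fun ζ hζ => H.2 ζ (h.symm.trans hζ)⟩⟩
  unfold eigenfrequency
  generalize IsEigenfrequency g ξ = P at h' ⊢
  subst h'
  rfl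

/-- The closed span of the matrix elements with eigenfrequency `r`. -/
def spectralSpace (r : ℝ) : Submodule ℂ (Lp ℂ 2 μ) :=
  (Submodule.span ℂ {f | ∃ (ξ : Irrep G) (i j : Fin ξ.dim),
    eigenfrequency g ξ = r ∧ ξ.element μ i j = f}).topologicalClosure

theorem element_mem_spectralSpace (ξ : Irrep G) (i j : Fin ξ.dim) :
    ξ.element μ i j ∈ spectralSpace μ g (eigenfrequency g ξ) :=
  Submodule.le_topologicalClosure _ (Submodule.subset_span ⟨ξ, i, j, rfl, rfl⟩)

theorem spectralSpace_le_orthogonal_singleton {r : ℝ} {f : Lp ℂ 2 μ}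
    (h : ∀ (ξ : Irrep G) (i j : Fin ξ.dim), eigenfrequency g ξ = r →
      inner ℂ (ξ.element μ i j) f = 0) : spectralSpace μ g r ≤ (ℂ ∙ f)ᗮ := by
  refine Submodule.topologicalClosure_minimal _ (Submodule.span_le.2 ?_)
    (Submodule.isClosed_orthogonal _)
  rintro _ ⟨ξ, i, j, hξ, rfl⟩
  exact Submodule.mem_orthogonal_singleton_iff_inner_left.2 (h ξ i j hξ)

/-- Different frequencies force inequivalent representations, so Schur orthogonality suffices and no
symmetry of `𝓛` enters. -/
theorem inner_eq_zero_of_mem_spectralSpace {r s : ℝ} (hrs : r ≠ s) {f h : Lp ℂ 2 μ}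
    (hf : f ∈ spectralSpace μ g r) (hh : h ∈ spectralSpace μ g s) : inner ℂ f h = 0 := by
  refine Submodule.mem_orthogonal_singleton_iff_inner_left.1
    (spectralSpace_le_orthogonal_singleton μ g (fun ξ i j hξ => ?_) hf)
  refine Submodule.mem_orthogonal_singleton_iff_inner_right.1
    (spectralSpace_le_orthogonal_singleton μ g (fun η k l hη => ?_) hh)
  refine inner_element_of_not_equivalent μ (fun he => hrs ?_) k l i j
  rw [← hξ, ← hη, eigenfrequency_congr g he]

theorem exists_hilbertBasis_spectralSpace :
    ∃ (ι : Type u) (r : ι → ℝ) (b : HilbertBasis ι ℂ (Lp ℂ 2 μ)),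
      ∀ k, b k ∈ spectralSpace μ g (r k) := by
  refine exists_hilbertBasis_of_closed_family (spectralSpace μ g)
    (fun r => Submodule.isClosed_topologicalClosure _)
    (fun r s hrs f hf h hh => inner_eq_zero_of_mem_spectralSpace μ g hrs hf hh) fun f hf => ?_
  have hle : (elementSpan μ).topologicalClosure ≤ (ℂ ∙ f)ᗮ := by
    refine Submodule.topologicalClosure_minimal _ (Submodule.span_le.2 ?_)
      (Submodule.isClosed_orthogonal _)
    rintro _ ⟨ξ, i, j, rfl⟩
    exact Submodule.mem_orthogonal_singleton_iff_inner_right.2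
      (hf _ _ (element_mem_spectralSpace μ g ξ i j))
  rw [topologicalClosure_elementSpan] at hle
  exact inner_self_eq_zero.1
    (Submodule.mem_orthogonal_singleton_iff_inner_right.1 (hle Submodule.mem_top))

variable {μ g}

theorem IsFracLaplacian.inner_element {s : ℝ} {f h : Lp ℂ 2 μ} (H : IsFracLaplacian g s f h)
    (ξ : Irrep G) (i j : Fin ξ.dim) : inner ℂ (ξ.element μ i j) h =
      (((eigenfrequency g ξ ^ 2) ^ s : ℝ) : ℂ) * inner ℂ (ξ.element μ i j) f := by
  have h' := congrFun (congrFun (H ξ) j) i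
  rwa [Matrix.smul_apply, fourier_apply, fourier_apply, smul_eq_mul] at h'

/-- Orthogonality to `h - (r²)^s f` is a closed linear condition on `v`, so it extends from matrix
elements to their closed span. -/
theorem IsFracLaplacian.inner_of_mem_spectralSpace {s r : ℝ} {f h v : Lp ℂ 2 μ}
    (H : IsFracLaplacian g s f h) (hv : v ∈ spectralSpace μ g r) :
    inner ℂ v h = (((r ^ 2) ^ s : ℝ) : ℂ) * inner ℂ v f := by
  have h' := Submodule.mem_orthogonal_singleton_iff_inner_left.1
    (spectralSpace_le_orthogonal_singleton (f := h - (((r ^ 2) ^ s : ℝ) : ℂ) • f) μ g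
      (fun ξ i j hξ => by
        rw [inner_sub_right, inner_smul_right, H.inner_element, hξ, sub_self]) hv)
  rwa [inner_sub_right, inner_smul_right, sub_eq_zero] at h'

theorem isFracLaplacian_of_mem_spectralSpace (s : ℝ) {r : ℝ} {v : Lp ℂ 2 μ}
    (hv : v ∈ spectralSpace μ g r) : IsFracLaplacian g s v ((((r ^ 2) ^ s : ℝ) : ℂ) • v) := by
  intro ξ
  ext i j
  rw [Matrix.smul_apply, fourier_apply, fourier_apply, inner_smul_right, smul_eq_mul]
  by_cases hξ : eigenfrequency g ξ = r
  · rw [hξ]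
  · rw [inner_eq_zero_of_mem_spectralSpace μ g hξ (element_mem_spectralSpace μ g ξ j i) hv,
      mul_zero, mul_zero]

/-- Fourier coefficients determine an `L²` function by Peter–Weyl; hence the choice in
`fracLaplacian` is harmless. -/
theorem IsFracLaplacian.unique {s : ℝ} {f h h' : Lp ℂ 2 μ} (H : IsFracLaplacian g s f h)
    (H' : IsFracLaplacian g s f h') : h = h' := by
  have hmem : h - h' ∈ (elementSpan μ)ᗮ := by
    refine (Submodule.mem_orthogonal _ _).2 fun v hv => ?_
    refine Submodule.mem_orthogonal_singleton_iff_inner_left.1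
      ((Submodule.span_le (p := (ℂ ∙ (h - h'))ᗮ)).2 ?_ hv)
    rintro _ ⟨ξ, i, j, rfl⟩
    refine Submodule.mem_orthogonal_singleton_iff_inner_left.2 ?_
    rw [inner_sub_right, H.inner_element, H'.inner_element, sub_self]
  rw [Submodule.topologicalClosure_eq_top_iff.1 (topologicalClosure_elementSpan μ),
    Submodule.mem_bot] at hmem
  exact sub_eq_zero.1 hmem

theorem MemSobolev.isFracLaplacian {α : ℝ} {f : Lp ℂ 2 μ} (H : MemSobolev g α f) :
    IsFracLaplacian g (α / 2) f (fracLaplacian g (α / 2) f) := by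
  have h : ∃ h : Lp ℂ 2 μ, IsFracLaplacian g (α / 2) f h := H
  rw [fracLaplacian, dif_pos h]
  exact h.choose_spec

theorem memSobolev_of_mem_spectralSpace (α : ℝ) {r : ℝ} {v : Lp ℂ 2 μ}
    (hv : v ∈ spectralSpace μ g r) : MemSobolev g α v :=
  ⟨_, isFracLaplacian_of_mem_spectralSpace _ hv⟩

theorem fracLaplacian_of_mem_spectralSpace (α : ℝ) {r : ℝ} {v : Lp ℂ 2 μ}
    (hv : v ∈ spectralSpace μ g r) :
    fracLaplacian g (α / 2) v = (((r ^ 2) ^ (α / 2) : ℝ) : ℂ) • v :=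
  (memSobolev_of_mem_spectralSpace α hv).isFracLaplacian.unique
    (isFracLaplacian_of_mem_spectralSpace _ hv)

end Spectral

/-! ## The harmonic oscillator -/

section Oscillator

variable {E : Type*} [NormedAddCommGroup E]

theorem eq_of_hasDerivAt_zero [NormedSpace ℝ E] [CompleteSpace E] {f : ℝ → E} {t : ℝ} (ht : 0 ≤ t)
    (hf : ContinuousOn f (Set.Icc 0 t)) (hf' : ∀ s ∈ Set.Ioo 0 t, HasDerivAt f 0 s) :
    f t = f 0 := by
  have h := intervalIntegral.integral_eq_sub_of_hasDerivAt_of_le ht hf hf' (by simp)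
  exact sub_eq_zero.1 (by simpa using h.symm)

/-- `sin (a x) / a`, or `x` if `a = 0`. -/
theorem exists_normalized_sin (a : ℝ) : ∃ S : ℝ → ℝ, S 0 = 0 ∧ (∀ x, |S x| ≤ |x|) ∧
    (∀ x, a * S x = Real.sin (a * x)) ∧ ∀ x, HasDerivAt S (Real.cos (a * x)) x := by
  rcases eq_or_ne a 0 with rfl | ha
  · exact ⟨id, rfl, fun x => le_rfl, fun x => by simp, fun x => by simpa using hasDerivAt_id x⟩
  · refine ⟨fun x => Real.sin (a * x) / a, by simp, fun x => ?_, fun x => by field_simp,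
      fun x => ?_⟩
    · rw [abs_div, div_le_iff₀ (abs_pos.2 ha), ← abs_mul, mul_comm x]
      exact Real.abs_sin_le_abs
    · have h := (((hasDerivAt_id x).const_mul a).sin).div_const a
      simpa [ha] using h

variable [InnerProductSpace ℝ E] {a t : ℝ} {φ ψ : ℝ → E}

/-- The derivative is `2⟪ψ, -a² φ⟫ + 2a² ⟪φ, ψ⟫ = 0`. -/
theorem oscillator_energy (ht : 0 ≤ t) (hφ : ContinuousOn φ (Set.Ici 0))
    (hψ : ContinuousOn ψ (Set.Ici 0)) (hφ' : ∀ s, 0 < s → HasDerivAt φ (ψ s) s)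
    (hψ' : ∀ s, 0 < s → HasDerivAt ψ (-(a ^ 2) • φ s) s) :
    ‖ψ t‖ ^ 2 + a ^ 2 * ‖φ t‖ ^ 2 = ‖ψ 0‖ ^ 2 + a ^ 2 * ‖φ 0‖ ^ 2 := by
  have hsub : Set.Icc 0 t ⊆ Set.Ici 0 := Set.Icc_subset_Ici_self
  refine eq_of_hasDerivAt_zero (f := fun s => ‖ψ s‖ ^ 2 + a ^ 2 * ‖φ s‖ ^ 2) ht ?_ fun s hs => ?_
  · exact ((hψ.mono hsub).norm.pow 2).add (continuousOn_const.mul ((hφ.mono hsub).norm.pow 2))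
  · refine ((hψ' s hs.1).norm_sq.add (((hφ' s hs.1).norm_sq).const_mul (a ^ 2))).congr_deriv ?_
    rw [real_inner_smul_right, real_inner_comm]
    ring

theorem oscillator_norm_le [CompleteSpace E] (ht : 0 ≤ t) (hφ : ContinuousOn φ (Set.Ici 0))
    (hψ : ContinuousOn ψ (Set.Ici 0)) (hφ' : ∀ s, 0 < s → HasDerivAt φ (ψ s) s)
    (hψ' : ∀ s, 0 < s → HasDerivAt ψ (-(a ^ 2) • φ s) s) :
    ‖φ t‖ ≤ ‖φ 0‖ + t * ‖ψ 0‖ := by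
  obtain ⟨S, hS₀, hS, hSa, hS'⟩ := exists_normalized_sin a
  have hsub : Set.Icc 0 t ⊆ Set.Ici 0 := Set.Icc_subset_Ici_self
  have hSc : Continuous S := continuous_iff_continuousAt.2 fun x => (hS' x).continuousAt
  -- Running the free evolution from time `s` to the fixed time `t` gives a quantity independent of
  -- `s`: at `s = t` it is `φ t`, at `s = 0` the explicit solution formula. This avoids a uniqueness
  -- theorem for the ODE.
  have hconst := eq_of_hasDerivAt_zero
    (f := fun s => Real.cos (a * (t - s)) • φ s + S (t - s) • ψ s) ht
    (((by fun_prop : Continuous fun s => Real.cos (a * (t - s))).continuousOn.smul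
      (hφ.mono hsub)).add
      ((hSc.comp (continuous_const.sub continuous_id)).continuousOn.smul (hψ.mono hsub)))
    fun s hs => by
      have hsub' : HasDerivAt (fun s => t - s) (-1) s := (hasDerivAt_id s).const_sub t
      refine (((hsub'.const_mul a).cos.smul (hφ' s hs.1)).add
        (((hS' (t - s)).comp s hsub').smul (hψ' s hs.1))).congr_deriv ?_
      simp only [Function.comp_apply, ← hSa]
      module
  simp only [sub_self, mul_zero, Real.cos_zero, one_smul, hS₀, zero_smul, add_zero, sub_zero]
    at hconst
  rw [hconst]
  refine (norm_add_le _ _).trans (add_le_add ?_ ?_)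
  · rw [norm_smul]
    exact mul_le_of_le_one_left (norm_nonneg _) (Real.abs_cos_le_one _)
  · rw [norm_smul]
    exact mul_le_mul_of_nonneg_right ((hS t).trans_eq (abs_of_nonneg ht)) (norm_nonneg _)

end Oscillator

/-! ## Estimates for solutions of the wave equation -/

section Wave

variable {n : ℕ} {G : Type u} [TopologicalSpace G] [Group G] [IsTopologicalGroup G]
  [CompactSpace G] [T2Space G] [SecondCountableTopology G]
  [ChartedSpace (EuclideanSpace ℝ (Fin n)) G] [IsManifold (𝓡 n) ∞ G]
  [MeasurableSpace G] [BorelSpace G]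
  {μ : Measure G} [μ.IsHaarMeasure] [IsProbabilityMeasure μ] {g : Metric n G}
  {α r t : ℝ} {u₀ u₁ v : Lp ℂ 2 μ} {u : ℝ → Lp ℂ 2 μ}

theorem IsSolution.hasDerivAt (H : IsSolution g α u₀ u₁ u) (ht : 0 < t) :
    HasDerivAt u (timeDeriv u t) t :=
  ((H.contDiff.differentiableOn one_ne_zero) t ht.le).hasDerivWithinAt.hasDerivAt (Ici_mem_nhds ht)

theorem IsSolution.continuousOn_timeDeriv (H : IsSolution g α u₀ u₁ u) :
    ContinuousOn (timeDeriv u) (Set.Ici 0) :=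
  H.contDiff.continuousOn_derivWithin (uniqueDiffOn_Ici 0) le_rfl

theorem IsSolution.hasDerivAt_inner (H : IsSolution g α u₀ u₁ u) (v : Lp ℂ 2 μ) (ht : 0 < t) :
    HasDerivAt (fun s => inner ℂ v (u s)) (inner ℂ v (timeDeriv u t)) t :=
  ((innerSL ℂ v).restrictScalars ℝ).hasFDerivAt.comp_hasDerivAt t (H.hasDerivAt ht)

/-- Basis vectors are admissible test functions. One factor `(r²)^(α/2)` comes from the test
function and one from `u t`. -/
theorem IsSolution.hasDerivAt_inner_timeDeriv (H : IsSolution g α u₀ u₁ u)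
    (hv : v ∈ spectralSpace μ g r) (ht : 0 < t) :
    HasDerivAt (fun s => inner ℂ v (timeDeriv u s))
      (-(((r ^ 2) ^ (α / 2)) ^ 2) • inner ℂ v (u t)) t := by
  refine (H.equation v (memSobolev_of_mem_spectralSpace α hv) t ht).congr_deriv ?_
  rw [fracLaplacian_of_mem_spectralSpace α hv, inner_smul_left,
    (H.memSobolev t ht.le).isFracLaplacian.inner_of_mem_spectralSpace hv, Complex.conj_ofReal,
    Complex.real_smul]
  push_cast
  ring

theorem IsSolution.mode_energy (H : IsSolution g α u₀ u₁ u) (hv : v ∈ spectralSpace μ g r)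
    (ht : 0 ≤ t) :
    ‖inner ℂ v (timeDeriv u t)‖ ^ 2 + ‖inner ℂ v (fracLaplacian g (α / 2) (u t))‖ ^ 2 =
      ‖inner ℂ v u₁‖ ^ 2 + ‖inner ℂ v (fracLaplacian g (α / 2) u₀)‖ ^ 2 := by
  have h := oscillator_energy ht (continuousOn_const.inner H.contDiff.continuousOn)
    (continuousOn_const.inner H.continuousOn_timeDeriv) (fun s hs => H.hasDerivAt_inner v hs)
    (fun s hs => H.hasDerivAt_inner_timeDeriv hv hs)
  have hfrac : ∀ s, 0 ≤ s → ‖inner ℂ v (fracLaplacian g (α / 2) (u s))‖ ^ 2 =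
      ((r ^ 2) ^ (α / 2)) ^ 2 * ‖inner ℂ v (u s)‖ ^ 2 := by
    intro s hs
    rw [(H.memSobolev s hs).isFracLaplacian.inner_of_mem_spectralSpace hv, norm_mul, mul_pow,
      Complex.norm_real, Real.norm_eq_abs, sq_abs]
  rw [hfrac t ht, ← H.initial_value, hfrac 0 le_rfl, ← H.initial_velocity]
  exact h

theorem IsSolution.mode_norm_le (H : IsSolution g α u₀ u₁ u) (hv : v ∈ spectralSpace μ g r)
    (ht : 0 ≤ t) : ‖inner ℂ v (u t)‖ ≤ ‖inner ℂ v u₀‖ + t * ‖inner ℂ v u₁‖ := by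
  rw [← H.initial_value, ← H.initial_velocity]
  exact oscillator_norm_le ht (continuousOn_const.inner H.contDiff.continuousOn)
    (continuousOn_const.inner H.continuousOn_timeDeriv) (fun s hs => H.hasDerivAt_inner v hs)
    (fun s hs => H.hasDerivAt_inner_timeDeriv hv hs)

/-- Conservation of energy. -/
theorem IsSolution.energy (H : IsSolution g α u₀ u₁ u) (ht : 0 ≤ t) :
    ‖timeDeriv u t‖ ^ 2 + ‖fracLaplacian g (α / 2) (u t)‖ ^ 2 =
      ‖u₁‖ ^ 2 + ‖fracLaplacian g (α / 2) u₀‖ ^ 2 := by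
  obtain ⟨ι, r, b, hb⟩ := exists_hilbertBasis_spectralSpace μ g
  have h₁ := (hasSum_norm_inner_sq b (timeDeriv u t)).add
    (hasSum_norm_inner_sq b (fracLaplacian g (α / 2) (u t)))
  have h₂ := (hasSum_norm_inner_sq b u₁).add
    (hasSum_norm_inner_sq b (fracLaplacian g (α / 2) u₀))
  -- The two Parseval series agree term by term, so their sums agree.
  simp only [fun k => H.mode_energy (hb k) ht] at h₁
  exact h₁.unique h₂

theorem IsSolution.norm_le (H : IsSolution g α u₀ u₁ u) (ht : 0 ≤ t) :
    ‖u t‖ ≤ 2 * (‖u₀‖ + t * ‖u₁‖) := by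
  obtain ⟨ι, r, b, hb⟩ := exists_hilbertBasis_spectralSpace μ g
  -- `(x + y)² ≤ 2(x² + y²)` in each mode costs a factor `√2`, which the constant `2` absorbs.
  have h : ‖u t‖ ^ 2 ≤ 2 * (‖u₀‖ ^ 2 + t ^ 2 * ‖u₁‖ ^ 2) := by
    refine hasSum_le (fun k => ?_) (hasSum_norm_inner_sq b (u t))
      (((hasSum_norm_inner_sq b u₀).add ((hasSum_norm_inner_sq b u₁).mul_left (t ^ 2))).mul_left 2)
    have hk := H.mode_norm_le (hb k) ht
    calc ‖inner ℂ (b k) (u t)‖ ^ 2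
        ≤ (‖inner ℂ (b k) u₀‖ + t * ‖inner ℂ (b k) u₁‖) ^ 2 := by gcongr
      _ ≤ _ := by linarith [sq_nonneg (‖inner ℂ (b k) u₀‖ - t * ‖inner ℂ (b k) u₁‖)]
  have h₀ := norm_nonneg u₀
  have h₁ := mul_nonneg ht (norm_nonneg u₁)
  refine abs_le_of_sq_le_sq' ?_ (by positivity) |>.2
  nlinarith [mul_nonneg h₀ h₁, sq_nonneg (t * ‖u₁‖)]

end Wave

end FracWave

end

theorem theorem1p1 {n : ℕ} {G : Type*} [TopologicalSpace G] [Group G]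
    [ChartedSpace (EuclideanSpace ℝ (Fin n)) G] [LieGroup (𝓡 n) ∞ G]
    [T2Space G] [CompactSpace G] [MeasurableSpace G] [BorelSpace G]
    (μ : Measure G) [μ.IsHaarMeasure] [IsProbabilityMeasure μ]
    (g : FracWave.Metric n G) (hg : FracWave.IsBiinvariant g)
    (α : ℝ) (hα₀ : 0 < α) (hα₁ : α < 1) :
    ∃ C : ℝ, 0 < C ∧ ∀ (u₀ u₁ : Lp ℂ 2 μ) (u : ℝ → Lp ℂ 2 μ),
      FracWave.MemSobolev g α u₀ → FracWave.IsSolution g α u₀ u₁ u →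
      ∀ t : ℝ, 0 ≤ t →
        ‖u t‖ ≤ C * (‖u₀‖ + t * ‖u₁‖) ∧
        ‖FracWave.fracLaplacian g (α / 2) (u t)‖ ≤
          C * (FracWave.sobolevNorm g α u₀ + ‖u₁‖) ∧
        ‖FracWave.timeDeriv u t‖ ≤ C * (FracWave.sobolevNorm g α u₀ + ‖u₁‖) := by
  have : IsTopologicalGroup G := topologicalGroup_of_lieGroup (𝓡 n) ∞
  have : SecondCountableTopology G :=
    ChartedSpace.secondCountable_of_sigmaCompact (EuclideanSpace ℝ (Fin n)) G
  refine ⟨2, two_pos, fun u₀ u₁ u _ H t ht => ⟨H.norm_le ht, ?_⟩⟩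
  have h := H.energy ht
  have h₀ := norm_nonneg (FracWave.fracLaplacian g (α / 2) u₀)
  have h₁ := norm_nonneg u₁
  have h₂ := norm_nonneg u₀
  -- Both remaining estimates follow from the energy identity by dropping one of its two nonnegative
  -- terms.
  have hbound : ∀ x : ℝ, x ^ 2 ≤ ‖u₁‖ ^ 2 + ‖FracWave.fracLaplacian g (α / 2) u₀‖ ^ 2 →
      x ≤ 2 * (FracWave.sobolevNorm g α u₀ + ‖u₁‖) := by
    intro x hx
    have hle : x ≤ ‖u₁‖ + ‖FracWave.fracLaplacian g (α / 2) u₀‖ :=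
      (abs_le_of_sq_le_sq' (by nlinarith [mul_nonneg h₀ h₁]) (by positivity)).2
    rw [FracWave.sobolevNorm]
    linarith
  exact ⟨hbound _ (by linarith [sq_nonneg ‖FracWave.timeDeriv u t‖]),
    hbound _ (by linarith [sq_nonneg ‖FracWave.fracLaplacian g (α / 2) (u t)‖])⟩
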